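/- Let $K$ be a field and let $0<n_1<n_2<n_3<n_4$ be integers with $\gcd(n_1,n_2,n_3,n_4)=1$. Let $C$ be the affine monomial curve $x_i=t^{n_i}$ $(1\le i\le 4)$, and let $I(C)\subset K[x_1,x_2,x_3,x_4]$ be the kernel of the $K$-algebra homomorphism $K[x_1,x_2,x_3,x_4]\to K[t]$, $x_i\mapsto t^{n_i}$. For a nonzero polynomial $f$ let $f_*$ be its homogeneous summand of least degree, and let $I(C)_*$ be the ideal generated by all $f_*$ with $0\neq f\in I(C)$. Assume that $C$ has Cohen–Macaulay tangent cone at the origin, i.e. that the ring $K[x_1,x_2,x_3,x_4]/I(C)_*$ is Cohen–Macaulay. Assume moreover that $I(C)$ is minimally generated by $$f_1=x_1^{a_1}-x_2^{a_{12}}x_3^{a_{13}},\quad f_2=x_2^{a_2}-x_3^{a_{23}}x_4^{a_{24}},\quad f_3=x_3^{a_3}-x_1^{a_{31}}x_4^{a_{34}},$$ $$f_4=x_4^{a_4}-x_1^{a_{41}}x_2^{a_{42}},\quad f_5=x_1^{a_{41}}x_3^{a_{23}}-x_2^{a_{12}}x_4^{a_{34}},$$ where $0<a_{ij}<a_j$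 for all exponents $a_{ij}$ that occur (case 2(a)), and that $a_{24}<a_{34}$ and $a_{13}\le a_{23}$. Put $$f_6=x_2^{a_2+a_{12}}-x_1^{a_1}x_3^{a_{23}-a_{13}}x_4^{a_{24}}.$$ Then $\{f_1,\dots,f_6\}$ is a standard basis of $I(C)$ with respect to the negative degree reverse lexicographic ordering with $x_4>x_3>x_2>x_1$. Moreover, in each of the following eight cases, $I(C)_*$ is minimally generated by the six (pairwise distinct) elements listed. 1. If $a_3<a_{31}+a_{34}$, $a_2+a_{12}<a_1+a_{24}+a_{23}-a_{13}$ and $a_{12}+a_{34}<a_{41}+a_{23}$: $$x_2^{a_{12}}x_3^{a_{13}},\ x_3^{a_{23}}x_4^{a_{24}},\ x_3^{a_3},\ x_4^{a_4},\ x_2^{a_{12}}x_4^{a_{34}},\ x_2^{a_2+a_{12}}.$$ 2. If $a_3<a_{31}+a_{34}$, $a_2+a_{12}<a_1+a_{24}+a_{23}-a_{13}$ and $a_{12}+a_{34}=a_{41}+a_{23}$: $$x_2^{a_{12}}x_3^{a_{13}},\ x_3^{a_{23}}x_4^{a_{24}},\ x_3^{a_3},\ x_4^{a_4},\ x_1^{a_{41}}x_3^{a_{23}}-x_2^{a_{12}}x_4^{a_{34}},\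 x_2^{a_2+a_{12}}.$$ 3. If $a_3<a_{31}+a_{34}$, $a_2+a_{12}=a_1+a_{24}+a_{23}-a_{13}$ and $a_{12}+a_{34}<a_{41}+a_{23}$: $$x_2^{a_{12}}x_3^{a_{13}},\ x_3^{a_{23}}x_4^{a_{24}},\ x_3^{a_3},\ x_4^{a_4},\ x_2^{a_{12}}x_4^{a_{34}},\ x_2^{a_2+a_{12}}-x_1^{a_1}x_3^{a_{23}-a_{13}}x_4^{a_{24}}.$$ 4. If $a_3<a_{31}+a_{34}$, $a_2+a_{12}=a_1+a_{24}+a_{23}-a_{13}$ and $a_{12}+a_{34}=a_{41}+a_{23}$: $$x_2^{a_{12}}x_3^{a_{13}},\ x_3^{a_{23}}x_4^{a_{24}},\ x_3^{a_3},\ x_4^{a_4},\ x_1^{a_{41}}x_3^{a_{23}}-x_2^{a_{12}}x_4^{a_{34}},\ x_2^{a_2+a_{12}}-x_1^{a_1}x_3^{a_{23}-a_{13}}x_4^{a_{24}}.$$ 5. If $a_3=a_{31}+a_{34}$, $a_2+a_{12}<a_1+a_{24}+a_{23}-a_{13}$ and $a_{12}+a_{34}<a_{41}+a_{23}$: $$x_2^{a_{12}}x_3^{a_{13}},\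 x_3^{a_{23}}x_4^{a_{24}},\ x_3^{a_3}-x_1^{a_{31}}x_4^{a_{34}},\ x_4^{a_4},\ x_2^{a_{12}}x_4^{a_{34}},\ x_2^{a_2+a_{12}}.$$ 6. If $a_3=a_{31}+a_{34}$, $a_2+a_{12}<a_1+a_{24}+a_{23}-a_{13}$ and $a_{12}+a_{34}=a_{41}+a_{23}$: $$x_2^{a_{12}}x_3^{a_{13}},\ x_3^{a_{23}}x_4^{a_{24}},\ x_3^{a_3}-x_1^{a_{31}}x_4^{a_{34}},\ x_4^{a_4},\ x_1^{a_{41}}x_3^{a_{23}}-x_2^{a_{12}}x_4^{a_{34}},\ x_2^{a_2+a_{12}}.$$ 7. If $a_3=a_{31}+a_{34}$, $a_2+a_{12}=a_1+a_{24}+a_{23}-a_{13}$ and $a_{12}+a_{34}<a_{41}+a_{23}$: $$x_2^{a_{12}}x_3^{a_{13}},\ x_3^{a_{23}}x_4^{a_{24}},\ x_3^{a_3}-x_1^{a_{31}}x_4^{a_{34}},\ x_4^{a_4},\ x_2^{a_{12}}x_4^{a_{34}},\ x_2^{a_2+a_{12}}-x_1^{a_1}x_3^{a_{23}-a_{13}}x_4^{a_{24}}.$$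 8. If $a_3=a_{31}+a_{34}$, $a_2+a_{12}=a_1+a_{24}+a_{23}-a_{13}$ and $a_{12}+a_{34}=a_{41}+a_{23}$: $$x_2^{a_{12}}x_3^{a_{13}},\ x_3^{a_{23}}x_4^{a_{24}},\ x_3^{a_3}-x_1^{a_{31}}x_4^{a_{34}},\ x_4^{a_4},\ x_1^{a_{41}}x_3^{a_{23}}-x_2^{a_{12}}x_4^{a_{34}},\ x_2^{a_2+a_{12}}-x_1^{a_1}x_3^{a_{23}-a_{13}}x_4^{a_{24}}.$$ -/

import Mathlib

namespace MonomialCurve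

noncomputable section

open MvPolynomial

/-- The toric ideal `I(C)` of the monomial curve `x_i = t ^ n_i`: the kernel of the `K`-algebra
homomorphism `K[x_1, …, x_d] → K[t]`, `x_i ↦ t ^ n_i`. -/
def toricIdeal (K : Type*) [Field K] {d : ℕ} (n : Fin d → ℕ) : Ideal (MvPolynomial (Fin d) K) :=
  RingHom.ker (aeval (fun i => (Polynomial.X : Polynomial K) ^ n i) :
    MvPolynomial (Fin d) K →ₐ[K] Polynomial K)

/-- The homogeneous summand `f_*` of least degree of `f` (it is `0` for `f = 0`). -/
def leastForm {K : Type*} [Field K] {d : ℕ} (f : MvPolynomial (Fin d) K) :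
    MvPolynomial (Fin d) K :=
  homogeneousComponent (sInf {k : ℕ | homogeneousComponent k f ≠ 0}) f

/-- The ideal `I_*` generated by the least homogeneous summands `f_*` of all `f ∈ I`. -/
def leastFormIdeal {K : Type*} [Field K] {d : ℕ} (I : Ideal (MvPolynomial (Fin d) K)) :
    Ideal (MvPolynomial (Fin d) K) :=
  Ideal.span {g | ∃ f ∈ I, g = leastForm f}

/-- `I` is minimally generated by the (pairwise distinct) members of the family `g`: they generate
`I`, and none of them lies in the ideal generated by the others. -/
def IsMinimallyGeneratedBy {R ι : Type*} [CommRing R] (I : Ideal R) (g : ι → R) : Prop :=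
  Ideal.span (Set.range g) = I ∧ ∀ i, g i ∉ Ideal.span (g '' {j | j ≠ i})

/-- A Noetherian local ring is Cohen-Macaulay if some regular sequence in its maximal ideal has
length equal to the Krull dimension (that is, depth equals dimension). -/
def IsCohenMacaulayLocalRing (R : Type*) [CommRing R] [IsLocalRing R] : Prop :=
  IsNoetherianRing R ∧ ∃ rs : List R, (∀ r ∈ rs, r ∈ IsLocalRing.maximalIdeal R) ∧
    RingTheory.Sequence.IsRegular R rs ∧ ((rs.length : ℕ) : WithBot ℕ∞) = ringKrullDim R

/-- A Noetherian ring is Cohen-Macaulay if all its localizations at maximal ideals are. -/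
def IsCohenMacaulayRing (R : Type*) [CommRing R] : Prop :=
  IsNoetherianRing R ∧ ∀ (m : Ideal R) [m.IsMaximal],
    IsCohenMacaulayLocalRing (Localization.AtPrime m)

/-- The monomial curve has Cohen-Macaulay tangent cone at the origin: the coordinate ring
`K[x_1, …, x_d] / I(C)_*` of the tangent cone is Cohen-Macaulay. -/
def HasCohenMacaulayTangentCone (K : Type*) [Field K] {d : ℕ} (n : Fin d → ℕ) : Prop :=
  IsCohenMacaulayRing (MvPolynomial (Fin d) K ⧸ leastFormIdeal (toricIdeal K n))

/-- The (strict) negative degree reverse lexicographic ordering with `x_d > ⋯ > x_2 > x_1`: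
`x ^ α > x ^ β` if `x ^ α` has smaller total degree, or the total degrees agree and, at the
smallest variable in which `α` and `β` differ, the exponent in `α` is the smaller one. -/
def NegDegRevLexGT {d : ℕ} (α β : Fin d →₀ ℕ) : Prop :=
  α.degree < β.degree ∨
    (α.degree = β.degree ∧ ∃ i, (∀ j, j < i → α j = β j) ∧ α i < β i)

/-- `x ^ α` is the leading (i.e. largest) monomial of `f` for the strict monomial ordering `gt`. -/
def IsLeadingExponent {K : Type*} [Field K] {d : ℕ}
    (gt : (Fin d →₀ ℕ) → (Fin d →₀ ℕ) → Prop) (f : MvPolynomial (Fin d) K)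
    (α : Fin d →₀ ℕ) : Prop :=
  α ∈ f.support ∧ ∀ β ∈ f.support, β ≠ α → gt α β

/-- The leading ideal of `S`, generated by the leading monomials of the nonzero elements of `S`. -/
def leadingIdeal {K : Type*} [Field K] {d : ℕ}
    (gt : (Fin d →₀ ℕ) → (Fin d →₀ ℕ) → Prop) (S : Set (MvPolynomial (Fin d) K)) :
    Ideal (MvPolynomial (Fin d) K) :=
  Ideal.span {p | ∃ f ∈ S, ∃ α, IsLeadingExponent gt f α ∧ p = monomial α 1}

/-- `G` is a standard basis of `I`: a finite subset of `I` with the same leading ideal. (Passing to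
the localization of the polynomial ring at the polynomials with leading monomial `1` does not
change the leading ideal of `I`.) -/
def IsStandardBasis {K : Type*} [Field K] {d : ℕ}
    (gt : (Fin d →₀ ℕ) → (Fin d →₀ ℕ) → Prop) (G : Set (MvPolynomial (Fin d) K))
    (I : Ideal (MvPolynomial (Fin d) K)) : Prop :=
  G.Finite ∧ G ⊆ (I : Set (MvPolynomial (Fin d) K)) ∧
    leadingIdeal gt G = leadingIdeal gt (I : Set (MvPolynomial (Fin d) K))

/-- The exponents occurring in the generators `f_1 = (1, (2, 3))`, `f_2 = (2, (3, 4))`,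
`f_3 = (3, (1, 4))`, `f_4 = (4, (1, 2))`, `f_5 = ((2, 4), (1, 3))`. -/
structure Exponents where
  (a1 a2 a3 a4 a12 a13 a23 a24 a31 a34 a41 a42 : ℕ)

/-- The variable `x_1`. -/
abbrev x1 (K : Type*) [Field K] : MvPolynomial (Fin 4) K := X 0

/-- The variable `x_2`. -/
abbrev x2 (K : Type*) [Field K] : MvPolynomial (Fin 4) K := X 1

/-- The variable `x_3`. -/
abbrev x3 (K : Type*) [Field K] : MvPolynomial (Fin 4) K := X 2

/-- The variable `x_4`. -/
abbrev x4 (K : Type*) [Field K] : MvPolynomial (Fin 4) K := X 3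

variable (K : Type*) [Field K] (a : Exponents)

/-- `f_1 = x_1^{a_1} - x_2^{a_12} x_3^{a_13}`. -/
def f1 : MvPolynomial (Fin 4) K := x1 K ^ a.a1 - x2 K ^ a.a12 * x3 K ^ a.a13

/-- `f_2 = x_2^{a_2} - x_3^{a_23} x_4^{a_24}`. -/
def f2 : MvPolynomial (Fin 4) K := x2 K ^ a.a2 - x3 K ^ a.a23 * x4 K ^ a.a24

/-- `f_3 = x_3^{a_3} - x_1^{a_31} x_4^{a_34}`. -/
def f3 : MvPolynomial (Fin 4) K := x3 K ^ a.a3 - x1 K ^ a.a31 * x4 K ^ a.a34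

/-- `f_4 = x_4^{a_4} - x_1^{a_41} x_2^{a_42}`. -/
def f4 : MvPolynomial (Fin 4) K := x4 K ^ a.a4 - x1 K ^ a.a41 * x2 K ^ a.a42

/-- `f_5 = x_1^{a_41} x_3^{a_23} - x_2^{a_12} x_4^{a_34}`. -/
def f5 : MvPolynomial (Fin 4) K := x1 K ^ a.a41 * x3 K ^ a.a23 - x2 K ^ a.a12 * x4 K ^ a.a34

/-- `f_6 = x_2^{a_2 + a_12} - x_1^{a_1} x_3^{a_23 - a_13} x_4^{a_24}`, used for `a_13 ≤ a_23`. -/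
def f6 : MvPolynomial (Fin 4) K :=
  x2 K ^ (a.a2 + a.a12) - x1 K ^ a.a1 * x3 K ^ (a.a23 - a.a13) * x4 K ^ a.a24

/-- `I(C)` is given as in case 2(a), with exponents `a`: `0 < a_ij < a_j`, and `I(C)` is minimally
generated by `f_1, …, f_5`. -/
structure IsCase2a (n : Fin 4 → ℕ) : Prop where
  h12 : 0 < a.a12 ∧ a.a12 < a.a2
  h13 : 0 < a.a13 ∧ a.a13 < a.a3
  h23 : 0 < a.a23 ∧ a.a23 < a.a3
  h24 : 0 < a.a24 ∧ a.a24 < a.a4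
  h31 : 0 < a.a31 ∧ a.a31 < a.a1
  h34 : 0 < a.a34 ∧ a.a34 < a.a4
  h41 : 0 < a.a41 ∧ a.a41 < a.a1
  h42 : 0 < a.a42 ∧ a.a42 < a.a2
  minGen : IsMinimallyGeneratedBy (toricIdeal K n) ![f1 K a, f2 K a, f3 K a, f4 K a, f5 K a]

end

end MonomialCurve

open MonomialCurve

/-! ### Arithmetic of the exponents: uniqueness of normal forms -/

namespace MonomialCurve

open MvPolynomial

/-! Give `x_i` the weight `n_i`. A binomial whose two monomials have equal weight lies in `I(C)`,
and in an element of `I(C)` the coefficients of the monomials of any given weight sum to zero. The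
theorem is therefore a statement about normal forms of monomials. Call a monomial standard if no
intended leading monomial of `f_1, …, f_6` divides it (`¬ LeadDvd`).

Uniqueness: standard monomials of equal weight coincide (`ExponentRelations.eq_of_not_leadDvd`). The
ideal `I(C)` lies in the monomial ideal generated by the ten monomials of `f_1, …, f_5`, so of two
distinct monomials of equal weight each is divisible by one of the ten. Applying this repeatedly
after cancelling common factors leaves no room for two different standard monomials.

Existence: replacing a leading monomial by the other monomial of its `f_i` preserves the weight and
either raises the degree or keeps the degree and raises the exponent of `x_1`. Since the weight
bounds the degree, rewriting ends (`exists_reducesTo_not_leadDvd`).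

That these replacements go in the right direction is `DegreeInequalities`. Three of the inequalities
follow from `n_1 < n_2 < n_3 < n_4`. The other three use Cohen-Macaulayness, which makes `x_1` a
nonzerodivisor modulo `I(C)_*` (`mem_leastFormIdeal_of_X_zero_mul_mem`): otherwise a monomial
containing `x_1` would be a least form, and cancelling `x_1` would leave a monomial divisible by
none of the ten.

A standard monomial cannot lead an element of `I(C)`, because it is the smallest of its weight; this
gives the standard basis. Following the degrees during rewriting shows that the least forms of the
`f_i` generate `I(C)_*`, and they do so minimally because no leading monomial divides another. -/

/-- The weight of the monomial `x_1 ^ p x_2 ^ q x_3 ^ r x_4 ^ s` when `x_i` has weight `n_i`. -/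
def quadWeight (n : Fin 4 → ℕ) (p q r s : ℕ) : ℕ := n 0 * p + n 1 * q + n 2 * r + n 3 * s

/-- `x_1 ^ p x_2 ^ q x_3 ^ r x_4 ^ s` is divisible by one of the ten monomials of
`f_1, …, f_5`. -/
def OccursDvd (a : Exponents) (p q r s : ℕ) : Prop :=
  a.a1 ≤ p ∨ (a.a12 ≤ q ∧ a.a13 ≤ r) ∨ a.a2 ≤ q ∨ (a.a23 ≤ r ∧ a.a24 ≤ s) ∨ a.a3 ≤ r ∨
    (a.a31 ≤ p ∧ a.a34 ≤ s) ∨ a.a4 ≤ s ∨ (a.a41 ≤ p ∧ a.a42 ≤ q) ∨ (a.a41 ≤ p ∧ a.a23 ≤ r) ∨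
    (a.a12 ≤ q ∧ a.a34 ≤ s)

/-- `x_1 ^ p x_2 ^ q x_3 ^ r x_4 ^ s` is divisible by the leading monomial of one of
`f_1, …, f_6`. -/
def LeadDvd (a : Exponents) (q r s : ℕ) : Prop :=
  (a.a12 ≤ q ∧ a.a13 ≤ r) ∨ (a.a23 ≤ r ∧ a.a24 ≤ s) ∨ a.a3 ≤ r ∨ a.a4 ≤ s ∨
    (a.a12 ≤ q ∧ a.a34 ≤ s) ∨ a.a2 + a.a12 ≤ q

/-- The numerical content of case 2(a): the bounds on the exponents, the weight equations of
`f_1, …, f_5`, and the fact that distinct monomials of equal weight are divisible by monomials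
of `f_1, …, f_5`. -/
structure ExponentRelations (a : Exponents) (n : Fin 4 → ℕ) : Prop where
  npos : ∀ i, 0 < n i
  h12 : 0 < a.a12 ∧ a.a12 < a.a2
  h13 : 0 < a.a13 ∧ a.a13 < a.a3
  h23 : 0 < a.a23 ∧ a.a23 < a.a3
  h24 : 0 < a.a24 ∧ a.a24 < a.a4
  h31 : 0 < a.a31 ∧ a.a31 < a.a1
  h34 : 0 < a.a34 ∧ a.a34 < a.a4
  h41 : 0 < a.a41 ∧ a.a41 < a.a1
  h42 : 0 < a.a42 ∧ a.a42 < a.a2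
  e1 : n 0 * a.a1 = n 1 * a.a12 + n 2 * a.a13
  e2 : n 1 * a.a2 = n 2 * a.a23 + n 3 * a.a24
  e3 : n 2 * a.a3 = n 0 * a.a31 + n 3 * a.a34
  e4 : n 3 * a.a4 = n 0 * a.a41 + n 1 * a.a42
  e5 : n 0 * a.a41 + n 2 * a.a23 = n 1 * a.a12 + n 3 * a.a34
  occurs : ∀ p q r s p' q' r' s', quadWeight n p q r s = quadWeight n p' q' r' s' →
    ¬ (p = p' ∧ q = q' ∧ r = r' ∧ s = s') → OccursDvd a p q r s

/-- If `x A + y B = x C + y D` in `ℕ` with `C < A`, the surpluses match. -/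
lemma exists_surplus {x y A B C D : ℕ} (hx : 0 < x) (h : x * A + y * B = x * C + y * D)
    (hAC : C < A) : ∃ d e, 0 < d ∧ A = C + d ∧ D = B + e ∧ x * d = y * e := by
  obtain ⟨d, rfl⟩ := Nat.exists_eq_add_of_lt hAC
  have hBD : B ≤ D := by
    by_contra! hlt
    have := Nat.mul_le_mul_left y hlt.le
    have : 0 < x * (d + 1) := by positivity
    nlinarith
  obtain ⟨e, rfl⟩ := Nat.exists_eq_add_of_le hBD
  exact ⟨d + 1, e, by omega, by omega, rfl, by nlinarith⟩

namespace ExponentRelations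

variable {a : Exponents} {n : Fin 4 → ℕ} (E : ExponentRelations a n)
include E

/-- Combining the weights of `f_1`, `f_3`, `f_5` cancels `x_2` and `x_4`. If the exponents did not
match, a pure power of `x_1` would have the weight of a pure power of `x_3`, one of them with
exponent below `a_1`, respectively `a_3`, and so divisible by none of the ten monomials. -/
lemma sum_one_three : a.a1 = a.a31 + a.a41 ∧ a.a3 = a.a13 + a.a23 := by
  have hp := E.npos
  have h := E.occurs
  have key : n 0 * a.a1 + n 2 * a.a3 = n 0 * (a.a31 + a.a41) + n 2 * (a.a13 + a.a23) := by
    linarith [E.e1, E.e3, E.e5]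
  obtain ⟨h12, h13, h23, h24, h31, h34, h41, h42⟩ :=
    (⟨E.h12, E.h13, E.h23, E.h24, E.h31, E.h34, E.h41, E.h42⟩ : _ ∧ _ ∧ _ ∧ _ ∧ _ ∧ _ ∧ _ ∧ _)
  rcases lt_trichotomy a.a1 (a.a31 + a.a41) with hlt | heq | hgt
  · obtain ⟨d, e, hd, h1, h3, hde⟩ := exists_surplus (hp 0) key.symm hlt
    have he : 0 < e := Nat.pos_of_mul_pos_left (hde ▸ Nat.mul_pos (hp 0) hd)
    have := h 0 0 e 0 d 0 0 0 (by simp [quadWeight, hde]) (by omega)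
    unfold OccursDvd at this
    omega
  · refine ⟨heq, ?_⟩
    rw [← heq] at key
    exact Nat.eq_of_mul_eq_mul_left (hp 2) (by linarith)
  · obtain ⟨d, e, hd, h1, h3, hde⟩ := exists_surplus (hp 0) key hgt
    have := h d 0 0 0 0 0 e 0 (by simp [quadWeight, hde]) (by omega)
    unfold OccursDvd at this
    omega

/-- The argument of `sum_one_three` for `x_2` and `x_4`, with `f_2`, `f_4`, `f_5`. -/
lemma sum_two_four : a.a2 = a.a12 + a.a42 ∧ a.a4 = a.a24 + a.a34 := by
  have hp := E.npos
  have h := E.occurs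
  have key : n 1 * a.a2 + n 3 * a.a4 = n 1 * (a.a12 + a.a42) + n 3 * (a.a24 + a.a34) := by
    linarith [E.e2, E.e4, E.e5]
  obtain ⟨h12, h13, h23, h24, h31, h34, h41, h42⟩ :=
    (⟨E.h12, E.h13, E.h23, E.h24, E.h31, E.h34, E.h41, E.h42⟩ : _ ∧ _ ∧ _ ∧ _ ∧ _ ∧ _ ∧ _ ∧ _)
  rcases lt_trichotomy a.a2 (a.a12 + a.a42) with hlt | heq | hgt
  · obtain ⟨d, e, hd, h1, h3, hde⟩ := exists_surplus (hp 1) key.symm hlt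
    have he : 0 < e := Nat.pos_of_mul_pos_left (hde ▸ Nat.mul_pos (hp 1) hd)
    have := h 0 0 0 e 0 d 0 0 (by simp [quadWeight, hde]) (by omega)
    unfold OccursDvd at this
    omega
  · refine ⟨heq, ?_⟩
    rw [← heq] at key
    exact Nat.eq_of_mul_eq_mul_left (hp 3) (by linarith)
  · obtain ⟨d, e, hd, h1, h3, hde⟩ := exists_surplus (hp 1) key hgt
    have := h 0 d 0 0 0 0 0 e (by simp [quadWeight, hde]) (by omega)
    unfold OccursDvd at this
    omega

/-- The core of uniqueness: after common factors are cancelled, one of the two monomials is free of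
`x_1`. Rewriting by `f_2` and then by `f_1` leads to a monomial too small to be divisible by any of
the ten. -/
lemma eq_of_coprime_of_left_eq_zero (hle : a.a13 ≤ a.a23) {q r s p' q' r' s' : ℕ}
    (hw : quadWeight n 0 q r s = quadWeight n p' q' r' s')
    (hq : q = 0 ∨ q' = 0) (hr : r = 0 ∨ r' = 0) (hs : s = 0 ∨ s' = 0)
    (hL : ¬ LeadDvd a q r s) (hL' : ¬ LeadDvd a q' r' s') :
    0 = p' ∧ q = q' ∧ r = r' ∧ s = s' := by
  by_contra hne
  obtain ⟨h12, h13, h23, h24, h31, h34, h41, h42⟩ :=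
    (⟨E.h12, E.h13, E.h23, E.h24, E.h31, E.h34, E.h41, E.h42⟩ : _ ∧ _ ∧ _ ∧ _ ∧ _ ∧ _ ∧ _ ∧ _)
  obtain ⟨-, s3⟩ := E.sum_one_three
  obtain ⟨s2, s4⟩ := E.sum_two_four
  have o := E.occurs _ _ _ _ _ _ _ _ hw hne
  have o' := E.occurs _ _ _ _ _ _ _ _ hw.symm (by omega)
  unfold LeadDvd at hL hL'
  -- Of the ten monomials, `x_2 ^ a_2` is the only one that neither contains `x_1` nor is excluded
  -- by `hL`.
  have hq2 : a.a2 ≤ q := by unfold OccursDvd at o; omega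
  have hp' : 0 < p' := by unfold OccursDvd at o'; omega
  obtain ⟨e, rfl⟩ := Nat.exists_eq_add_of_le hq2
  obtain rfl : q' = 0 := by omega
  have he : e < a.a12 := by omega
  have hr13 : r < a.a13 := by omega
  have hs34 : s < a.a34 := by omega
  -- replace `x_2 ^ a_2` by `x_3 ^ a_23 x_4 ^ a_24` and cancel common factors
  have hw2 : quadWeight n 0 e (r + a.a23) (s + a.a24) = quadWeight n p' 0 r' s' := by
    rw [← hw]
    unfold quadWeight
    linarith [E.e2]
  have hmin3 : ∃ c u v, r + a.a23 = c + u ∧ r' = c + v ∧ (u = 0 ∨ v = 0) :=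
    ⟨min (r + a.a23) r', r + a.a23 - r', r' - (r + a.a23), by omega, by omega, by omega⟩
  have hmin4 : ∃ c u v, s + a.a24 = c + u ∧ s' = c + v ∧ (u = 0 ∨ v = 0) :=
    ⟨min (s + a.a24) s', s + a.a24 - s', s' - (s + a.a24), by omega, by omega, by omega⟩
  obtain ⟨c, u, v, hu, hv, huv⟩ := hmin3
  obtain ⟨c', u', v', hu', hv', huv'⟩ := hmin4
  have hw3 : quadWeight n 0 e u u' = quadWeight n p' 0 v v' := by
    rw [hu, hu', hv, hv'] at hw2
    unfold quadWeight at hw2 ⊢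
    linarith
  have o3 := E.occurs _ _ _ _ _ _ _ _ hw3 (by omega)
  have o4 := E.occurs _ _ _ _ _ _ _ _ hw3.symm (by omega)
  -- Here `e < a_12`, `u < a_13 + a_23 = a_3` and `u' < a_24 + a_34 = a_4`, which leaves only `x_3 ^
  -- a_23 x_4 ^ a_24`.
  have hu23 : a.a23 ≤ u ∧ a.a24 ≤ u' := by unfold OccursDvd at o3; omega
  obtain rfl : v = 0 := by omega
  obtain rfl : v' = 0 := by omega
  have hp1 : a.a1 ≤ p' := by unfold OccursDvd at o4; omega
  -- replace `x_1 ^ a_1` by `x_2 ^ a_12 x_3 ^ a_13` and cancel common factors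
  obtain ⟨k, rfl⟩ := Nat.exists_eq_add_of_le hp1
  obtain ⟨g, hg⟩ := Nat.exists_eq_add_of_lt he
  obtain ⟨t, rfl⟩ := Nat.exists_eq_add_of_le (hle.trans hu23.1)
  have hw4 : quadWeight n 0 0 t u' = quadWeight n k (g + 1) 0 0 := by
    have := E.e1
    rw [hg] at this
    unfold quadWeight at hw3 ⊢
    linarith
  -- Contradiction: `t = u - a_13 < a_23` and `u' < a_4`, so `x_3 ^ t x_4 ^ u'` is divisible by none
  -- of the ten.
  have o5 := E.occurs _ _ _ _ _ _ _ _ hw4 (by omega)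
  unfold OccursDvd at o5
  omega

/-- Monomials outside the ideal of leading monomials are determined by their weight. -/
lemma eq_of_not_leadDvd (hle : a.a13 ≤ a.a23) {p q r s p' q' r' s' : ℕ}
    (hw : quadWeight n p q r s = quadWeight n p' q' r' s')
    (hL : ¬ LeadDvd a q r s) (hL' : ¬ LeadDvd a q' r' s') :
    p = p' ∧ q = q' ∧ r = r' ∧ s = s' := by
  have split : ∀ x y : ℕ, ∃ c u v, x = c + u ∧ y = c + v ∧ (u = 0 ∨ v = 0) := fun x y =>
    ⟨min x y, x - y, y - x, by omega, by omega, by omega⟩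
  obtain ⟨c0, u0, v0, rfl, rfl, h0⟩ := split p p'
  obtain ⟨c1, u1, v1, rfl, rfl, h1⟩ := split q q'
  obtain ⟨c2, u2, v2, rfl, rfl, h2⟩ := split r r'
  obtain ⟨c3, u3, v3, rfl, rfl, h3⟩ := split s s'
  have hw' : quadWeight n u0 u1 u2 u3 = quadWeight n v0 v1 v2 v3 := by
    unfold quadWeight at hw ⊢
    linarith
  unfold LeadDvd at hL hL'
  rcases h0 with rfl | rfl
  · have := E.eq_of_coprime_of_left_eq_zero hle hw' h1 h2 h3
      (by unfold LeadDvd; omega) (by unfold LeadDvd; omega)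
    omega
  · have := E.eq_of_coprime_of_left_eq_zero hle hw'.symm h1.symm h2.symm h3.symm
      (by unfold LeadDvd; omega) (by unfold LeadDvd; omega)
    omega

end ExponentRelations

end MonomialCurve

/-! ### Toric ideals, least forms and leading exponents of binomials -/

namespace MonomialCurve

open MvPolynomial

section General

variable {K : Type*} [Field K] {d : ℕ}

/-- The weight of the exponent `α` when the `i`-th variable has weight `n i`. -/
def expWeight (n : Fin d → ℕ) (α : Fin d →₀ ℕ) : ℕ := ∑ i, n i * α i

lemma expWeight_add (n : Fin d → ℕ) (α β : Fin d →₀ ℕ) :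
    expWeight n (α + β) = expWeight n α + expWeight n β := by
  simp [expWeight, mul_add, Finset.sum_add_distrib]

lemma aeval_X_pow_monomial (n : Fin d → ℕ) (α : Fin d →₀ ℕ) (c : K) :
    aeval (fun i => (Polynomial.X : Polynomial K) ^ n i) (monomial α c) =
      Polynomial.monomial (expWeight n α) c := by
  rw [aeval_monomial, Finsupp.prod_fintype _ _ (by simp), ← Polynomial.C_mul_X_pow_eq_monomial]
  simp [expWeight, ← pow_mul, Finset.prod_pow_eq_pow_sum]

/-- A linear functional of the weights of the monomials vanishes on the toric ideal. -/
lemma sum_smul_expWeight_eq_zero {V : Type*} [AddCommGroup V] [Module K V] {n : Fin d → ℕ}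
    {f : MvPolynomial (Fin d) K} (hf : f ∈ toricIdeal K n) (φ : ℕ → V) :
    ∑ α ∈ f.support, coeff α f • φ (expWeight n α) = 0 := by
  have h0 : aeval (fun i => (Polynomial.X : Polynomial K) ^ n i) f = 0 := hf
  rw [f.as_sum, map_sum] at h0
  simp only [aeval_X_pow_monomial] at h0
  have := congrArg (Polynomial.lsum fun k => LinearMap.toSpanSingleton K V (φ k)) h0
  rw [map_sum, map_zero] at this
  rw [← this]
  refine Finset.sum_congr rfl fun α _ => ?_
  rw [Polynomial.lsum_apply, Polynomial.sum_monomial_index _ _ (by simp)]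
  simp

/-- A monomial of an element of the toric ideal is cancelled by another one of the same weight. -/
lemma exists_ne_expWeight_eq {n : Fin d → ℕ} {f : MvPolynomial (Fin d) K}
    (hf : f ∈ toricIdeal K n) {α : Fin d →₀ ℕ} (hα : α ∈ f.support) :
    ∃ β ∈ f.support, β ≠ α ∧ expWeight n β = expWeight n α := by
  classical
  by_contra! hne
  have := sum_smul_expWeight_eq_zero hf fun k => if k = expWeight n α then (1 : K) else 0
  rw [Finset.sum_eq_single_of_mem α hα fun β hβ hβα => by simp [hne β hβ hβα]] at this
  simp only [↓reduceIte, smul_eq_mul, mul_one] at this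
  exact mem_support_iff.mp hα this

lemma monomial_sub_monomial_mem_toricIdeal {n : Fin d → ℕ} {α β : Fin d →₀ ℕ}
    (h : expWeight n α = expWeight n β) :
    monomial α (1 : K) - monomial β 1 ∈ toricIdeal K n := by
  change aeval (fun i => (Polynomial.X : Polynomial K) ^ n i) _ = 0
  rw [map_sub, aeval_X_pow_monomial, aeval_X_pow_monomial, h, sub_self]

lemma expWeight_eq_of_mem_toricIdeal {n : Fin d → ℕ} {α β : Fin d →₀ ℕ}
    (h : monomial α (1 : K) - monomial β 1 ∈ toricIdeal K n) :
    expWeight n α = expWeight n β := by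
  have h0 : aeval (fun i => (Polynomial.X : Polynomial K) ^ n i)
    (monomial α (1 : K) - monomial β 1) = 0 := h
  rw [map_sub, aeval_X_pow_monomial, aeval_X_pow_monomial, sub_eq_zero] at h0
  have := congrArg Polynomial.natDegree h0
  rwa [Polynomial.natDegree_monomial_eq _ one_ne_zero,
    Polynomial.natDegree_monomial_eq _ one_ne_zero] at this

lemma mem_support_monomial_sub_monomial {α β γ : Fin d →₀ ℕ} (hne : α ≠ β) :
    γ ∈ (monomial α (1 : K) - monomial β 1).support ↔ γ = α ∨ γ = β := by
  classical
  rw [mem_support_iff, coeff_sub, coeff_monomial, coeff_monomial]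
  by_cases h1 : α = γ <;> by_cases h2 : β = γ <;> simp_all [eq_comm]

lemma mem_restrictSupportIdeal {s : Set (Fin d →₀ ℕ)} {hs : IsUpperSet s}
    {f : MvPolynomial (Fin d) K} :
    f ∈ restrictSupportIdeal K s hs ↔ ∀ α ∈ f.support, α ∈ s := Iff.rfl

/-- The least form of `f` is a homogeneous component, of degree at most that of any monomial. -/
lemma exists_leastForm_eq (f : MvPolynomial (Fin d) K) :
    ∃ k, leastForm f = homogeneousComponent k f ∧ ∀ α ∈ f.support, k ≤ α.degree := by
  refine ⟨_, rfl, fun α hα => Nat.sInf_le fun h0 => ?_⟩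
  have := congrArg (coeff α) h0
  rw [coeff_homogeneousComponent, if_pos rfl] at this
  exact mem_support_iff.mp hα this

lemma leastForm_eq_of_mem_support {f : MvPolynomial (Fin d) K} {α : Fin d →₀ ℕ}
    (hα : α ∈ f.support) (h : ∀ β ∈ f.support, α.degree ≤ β.degree) :
    leastForm f = homogeneousComponent α.degree f := by
  obtain ⟨k, hk, hle⟩ := exists_leastForm_eq f
  have hk' : homogeneousComponent k f ≠ 0 := by
    rw [← hk]
    refine Nat.sInf_mem (s := {k : ℕ | homogeneousComponent k f ≠ 0}) ⟨α.degree, fun h0 => ?_⟩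
    have := congrArg (coeff α) h0
    rw [coeff_homogeneousComponent, if_pos rfl] at this
    exact mem_support_iff.mp hα this
  obtain ⟨β, hβ⟩ := MvPolynomial.ne_zero_iff.mp hk'
  rw [coeff_homogeneousComponent] at hβ
  split_ifs at hβ with hβk
  swap
  · exact absurd rfl hβ
  subst hβk
  rw [hk, (hle α hα).antisymm (h β (mem_support_iff.mpr hβ))]

lemma support_leastForm_subset (f : MvPolynomial (Fin d) K) :
    (leastForm f).support ⊆ f.support := by
  intro α hα
  rw [mem_support_iff] at hα ⊢
  intro h0
  exact hα (by rw [leastForm, coeff_homogeneousComponent, h0, ite_self])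

lemma leastForm_monomial_sub_monomial_of_lt {α β : Fin d →₀ ℕ} (h : α.degree < β.degree) :
    leastForm (monomial α (1 : K) - monomial β 1) = monomial α 1 := by
  have hne : α ≠ β := by rintro rfl; exact lt_irrefl _ h
  rw [leastForm_eq_of_mem_support ((mem_support_monomial_sub_monomial hne).mpr (.inl rfl))]
  · classical
    ext γ
    rw [coeff_homogeneousComponent, coeff_sub, coeff_monomial, coeff_monomial]
    by_cases h1 : α = γ
    · subst h1; simp [hne.symm]
    · by_cases h2 : β = γ
      · subst h2; simp [h.ne', hne]
      · simp [h1, h2]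
  · intro γ hγ
    rcases (mem_support_monomial_sub_monomial hne).mp hγ with rfl | rfl
    exacts [le_rfl, h.le]

lemma leastForm_monomial_sub_monomial_of_eq {α β : Fin d →₀ ℕ} (hne : α ≠ β)
    (h : α.degree = β.degree) :
    leastForm (monomial α (1 : K) - monomial β 1) = monomial α 1 - monomial β 1 := by
  rw [leastForm_eq_of_mem_support ((mem_support_monomial_sub_monomial hne).mpr (.inl rfl))]
  · classical
    ext γ
    rw [coeff_homogeneousComponent, ite_eq_left_iff]
    intro hγ
    by_contra h0
    rcases (mem_support_monomial_sub_monomial hne).mp (mem_support_iff.mpr (Ne.symm h0)) with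
      rfl | rfl
    exacts [hγ rfl, hγ h.symm]
  · intro γ hγ
    rcases (mem_support_monomial_sub_monomial hne).mp hγ with rfl | rfl
    exacts [le_rfl, h.le]

lemma leastForm_mem_leastFormIdeal {I : Ideal (MvPolynomial (Fin d) K)}
    {f : MvPolynomial (Fin d) K} (hf : f ∈ I) : leastForm f ∈ leastFormIdeal I :=
  Ideal.subset_span ⟨f, hf, rfl⟩

lemma leastFormIdeal_le_restrictSupportIdeal {I : Ideal (MvPolynomial (Fin d) K)}
    {s : Set (Fin d →₀ ℕ)} {hs : IsUpperSet s} (h : I ≤ restrictSupportIdeal K s hs) :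
    leastFormIdeal I ≤ restrictSupportIdeal K s hs := by
  rw [leastFormIdeal, Ideal.span_le]
  rintro _ ⟨f, hf, rfl⟩
  exact mem_restrictSupportIdeal.mpr fun α hα => h hf (support_leastForm_subset f hα)

lemma isLeadingExponent_monomial_sub_monomial {gt : (Fin d →₀ ℕ) → (Fin d →₀ ℕ) → Prop}
    {α β : Fin d →₀ ℕ} (hne : α ≠ β) (h : gt α β) :
    IsLeadingExponent gt (monomial α (1 : K) - monomial β 1) α := by
  refine ⟨(mem_support_monomial_sub_monomial hne).mpr (.inl rfl), fun γ hγ hγα => ?_⟩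
  rcases (mem_support_monomial_sub_monomial hne).mp hγ with rfl | rfl
  exacts [absurd rfl hγα, h]

lemma IsLeadingExponent.neg {gt : (Fin d →₀ ℕ) → (Fin d →₀ ℕ) → Prop}
    {f : MvPolynomial (Fin d) K} {α : Fin d →₀ ℕ} (h : IsLeadingExponent gt f α) :
    IsLeadingExponent gt (-f) α := by
  simpa [IsLeadingExponent] using h

/-- Minimal generation is insensitive to changing signs. -/
lemma IsMinimallyGeneratedBy.of_eq_or_eq_neg {R ι : Type*} [CommRing R] {I : Ideal R}
    {g h : ι → R} (hg : IsMinimallyGeneratedBy I g) (hgh : ∀ i, h i = g i ∨ h i = -g i) :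
    IsMinimallyGeneratedBy I h := by
  have key : ∀ s : Set ι, Ideal.span (h '' s) = Ideal.span (g '' s) := by
    intro s
    apply le_antisymm
    · rw [Ideal.span_le]
      rintro _ ⟨i, hi, rfl⟩
      have := Ideal.subset_span (Set.mem_image_of_mem g hi)
      rcases hgh i with h1 | h1 <;> rw [h1]
      exacts [this, neg_mem this]
    · rw [Ideal.span_le]
      rintro _ ⟨i, hi, rfl⟩
      have := Ideal.subset_span (Set.mem_image_of_mem h hi)
      rcases hgh i with h1 | h1 <;> rw [h1] at this
      exacts [this, neg_mem_iff.mp this]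
  refine ⟨?_, fun i => ?_⟩
  · rw [← hg.1, ← Set.image_univ, ← Set.image_univ, key]
  · rw [key]
    have := hg.2 i
    rcases hgh i with h1 | h1 <;> rw [h1]
    exacts [this, fun h2 => this (neg_mem_iff.mp h2)]

end General

/-- The exponent of `x_1 ^ p x_2 ^ q x_3 ^ r x_4 ^ s`. -/
noncomputable def quadExp (p q r s : ℕ) : Fin 4 →₀ ℕ := Finsupp.equivFunOnFinite.symm ![p, q, r, s]

section Quad

variable (p q r s : ℕ)

@[simp] lemma quadExp_zero : quadExp p q r s 0 = p := rfl
@[simp] lemma quadExp_one : quadExp p q r s 1 = q := rfl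
@[simp] lemma quadExp_two : quadExp p q r s 2 = r := rfl
@[simp] lemma quadExp_three : quadExp p q r s 3 = s := rfl

lemma quadExp_degree : (quadExp p q r s).degree = p + q + r + s := by
  simp [Finsupp.degree_eq_sum, Fin.sum_univ_four]

lemma expWeight_eq_quadWeight (n : Fin 4 → ℕ) (α : Fin 4 →₀ ℕ) :
    expWeight n α = quadWeight n (α 0) (α 1) (α 2) (α 3) := by
  simp [expWeight, quadWeight, Fin.sum_univ_four]

lemma quadExp_le_iff (α : Fin 4 →₀ ℕ) :
    quadExp p q r s ≤ α ↔ p ≤ α 0 ∧ q ≤ α 1 ∧ r ≤ α 2 ∧ s ≤ α 3 := by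
  rw [← Finsupp.coe_le_coe, Pi.le_def]
  simp [Fin.forall_fin_succ]

lemma exp_ext_iff (α β : Fin 4 →₀ ℕ) :
    α = β ↔ α 0 = β 0 ∧ α 1 = β 1 ∧ α 2 = β 2 ∧ α 3 = β 3 := by
  rw [DFunLike.ext_iff]
  simp [Fin.forall_fin_succ]

lemma monomial_quadExp (K : Type*) [Field K] :
    monomial (quadExp p q r s) (1 : K) = x1 K ^ p * x2 K ^ q * x3 K ^ r * x4 K ^ s := by
  rw [monomial_eq, Finsupp.prod_fintype _ _ (by simp)]
  simp [Fin.prod_univ_four]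

end Quad

/-! ### From minimal generators to numerical relations -/

section Case2a

variable {K : Type*} [Field K] {a : Exponents} {n : Fin 4 → ℕ}

/-- The exponents divisible by one of the monomials of `f_1, …, f_5`. -/
def occursSet (a : Exponents) : Set (Fin 4 →₀ ℕ) := {α | OccursDvd a (α 0) (α 1) (α 2) (α 3)}

lemma isUpperSet_occursSet (a : Exponents) : IsUpperSet (occursSet a) := by
  intro α β h
  have h0 := h 0
  have h1 := h 1
  have h2 := h 2
  have h3 := h 3
  simp only [occursSet, Set.mem_ofPred_eq, OccursDvd]
  omega

variable (K a) in
lemma f1_eq : f1 K a = monomial (quadExp a.a1 0 0 0) 1 - monomial (quadExp 0 a.a12 a.a13 0) 1 := by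
  simp [monomial_quadExp, f1]

variable (K a) in
lemma f2_eq : f2 K a = monomial (quadExp 0 a.a2 0 0) 1 - monomial (quadExp 0 0 a.a23 a.a24) 1 := by
  simp [monomial_quadExp, f2]

variable (K a) in
lemma f3_eq : f3 K a = monomial (quadExp 0 0 a.a3 0) 1 - monomial (quadExp a.a31 0 0 a.a34) 1 := by
  simp [monomial_quadExp, f3]

variable (K a) in
lemma f4_eq : f4 K a = monomial (quadExp 0 0 0 a.a4) 1 - monomial (quadExp a.a41 a.a42 0 0) 1 := by
  simp [monomial_quadExp, f4]

variable (K a) in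
lemma f5_eq : f5 K a =
    monomial (quadExp a.a41 0 a.a23 0) 1 - monomial (quadExp 0 a.a12 0 a.a34) 1 := by
  simp [monomial_quadExp, f5]

variable (K a) in
lemma f6_eq : f6 K a = monomial (quadExp 0 (a.a2 + a.a12) 0 0) 1 -
    monomial (quadExp a.a1 0 (a.a23 - a.a13) a.a24) 1 := by
  simp [monomial_quadExp, f6]

lemma IsCase2a.toricIdeal_le (ha : IsCase2a K a n) :
    toricIdeal K n ≤ restrictSupportIdeal K _ (isUpperSet_occursSet a) := by
  classical
  rw [← ha.minGen.1, Ideal.span_le]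
  have mono : ∀ p q r s, OccursDvd a p q r s →
      monomial (quadExp p q r s) (1 : K) ∈ restrictSupportIdeal K _ (isUpperSet_occursSet a) := by
    intro p q r s h α hα
    obtain rfl := Finset.mem_singleton.mp (support_monomial_subset hα)
    exact h
  rintro _ ⟨i, rfl⟩
  fin_cases i
  · simp only [Fin.zero_eta, Matrix.cons_val_zero, f1_eq]
    exact sub_mem (mono _ _ _ _ (by simp [OccursDvd])) (mono _ _ _ _ (by simp [OccursDvd]))
  · change f2 K a ∈ _
    rw [f2_eq]
    exact sub_mem (mono _ _ _ _ (by simp [OccursDvd])) (mono _ _ _ _ (by simp [OccursDvd]))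
  · change f3 K a ∈ _
    rw [f3_eq]
    exact sub_mem (mono _ _ _ _ (by simp [OccursDvd])) (mono _ _ _ _ (by simp [OccursDvd]))
  · change f4 K a ∈ _
    rw [f4_eq]
    exact sub_mem (mono _ _ _ _ (by simp [OccursDvd])) (mono _ _ _ _ (by simp [OccursDvd]))
  · change f5 K a ∈ _
    rw [f5_eq]
    exact sub_mem (mono _ _ _ _ (by simp [OccursDvd])) (mono _ _ _ _ (by simp [OccursDvd]))

/-- The weight equations hold because each `f_i` is in the kernel. The property `occurs` is
`IsCase2a.toricIdeal_le` applied to the binomial of two monomials of equal weight. -/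
lemma IsCase2a.exponentRelations (ha : IsCase2a K a n) (hpos : ∀ i, 0 < n i) :
    ExponentRelations a n := by
  have mem : ∀ i, ![f1 K a, f2 K a, f3 K a, f4 K a, f5 K a] i ∈ toricIdeal K n := fun i => by
    rw [← ha.minGen.1]
    exact Ideal.subset_span ⟨i, rfl⟩
  have m1 : f1 K a ∈ toricIdeal K n := mem 0
  have m2 : f2 K a ∈ toricIdeal K n := mem 1
  have m3 : f3 K a ∈ toricIdeal K n := mem 2
  have m4 : f4 K a ∈ toricIdeal K n := mem 3
  have m5 : f5 K a ∈ toricIdeal K n := mem 4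
  rw [f1_eq] at m1
  rw [f2_eq] at m2
  rw [f3_eq] at m3
  rw [f4_eq] at m4
  rw [f5_eq] at m5
  replace m1 := expWeight_eq_of_mem_toricIdeal m1
  replace m2 := expWeight_eq_of_mem_toricIdeal m2
  replace m3 := expWeight_eq_of_mem_toricIdeal m3
  replace m4 := expWeight_eq_of_mem_toricIdeal m4
  replace m5 := expWeight_eq_of_mem_toricIdeal m5
  simp only [expWeight_eq_quadWeight, quadWeight, quadExp_zero, quadExp_one, quadExp_two,
    quadExp_three, mul_zero, add_zero, zero_add] at m1 m2 m3 m4 m5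
  refine ⟨hpos, ha.h12, ha.h13, ha.h23, ha.h24, ha.h31, ha.h34, ha.h41, ha.h42,
    m1, m2, m3, m4, m5, ?_⟩
  intro p q r s p' q' r' s' hw hne
  have hne' : quadExp p q r s ≠ quadExp p' q' r' s' := by
    rw [Ne, exp_ext_iff]
    exact hne
  have hmem : monomial (quadExp p q r s) (1 : K) - monomial (quadExp p' q' r' s') 1 ∈
      toricIdeal K n := by
    apply monomial_sub_monomial_mem_toricIdeal
    rw [expWeight_eq_quadWeight, expWeight_eq_quadWeight]
    exact hw
  exact ha.toricIdeal_le hmem ((mem_support_monomial_sub_monomial hne').mpr (.inl rfl))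

end Case2a

end MonomialCurve

/-! ### Rewriting to normal form, standard basis and initial forms -/

namespace MonomialCurve

open MvPolynomial

/-- The exponents of the leading monomials of `f_1, …, f_6`. -/
noncomputable def leadExp (a : Exponents) : Fin 6 → (Fin 4 →₀ ℕ) :=
  ![quadExp 0 a.a12 a.a13 0, quadExp 0 0 a.a23 a.a24, quadExp 0 0 a.a3 0, quadExp 0 0 0 a.a4,
    quadExp 0 a.a12 0 a.a34, quadExp 0 (a.a2 + a.a12) 0 0]

/-- The exponents of the other monomials of `f_1, …, f_6`. -/
noncomputable def tailExp (a : Exponents) : Fin 6 → (Fin 4 →₀ ℕ) :=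
  ![quadExp a.a1 0 0 0, quadExp 0 a.a2 0 0, quadExp a.a31 0 0 a.a34, quadExp a.a41 a.a42 0 0,
    quadExp a.a41 0 a.a23 0, quadExp a.a1 0 (a.a23 - a.a13) a.a24]

/-- The least forms of `f_1, …, f_6` up to sign. -/
noncomputable def initialForm (K : Type*) [Field K] (a : Exponents) (i : Fin 6) :
    MvPolynomial (Fin 4) K :=
  if (leadExp a i).degree = (tailExp a i).degree then
    monomial (leadExp a i) 1 - monomial (tailExp a i) 1
  else monomial (leadExp a i) 1

/-- The inequalities between degrees that make `leadExp` the leading exponents. -/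
structure DegreeInequalities (a : Exponents) : Prop where
  d1 : a.a12 + a.a13 < a.a1
  d2 : a.a23 + a.a24 < a.a2
  d3 : a.a3 ≤ a.a31 + a.a34
  d4 : a.a4 < a.a41 + a.a42
  d5 : a.a12 + a.a34 ≤ a.a41 + a.a23
  d6 : a.a2 + a.a12 ≤ a.a1 + a.a24 + (a.a23 - a.a13)

lemma exists_leadExp_le_iff (a : Exponents) (α : Fin 4 →₀ ℕ) :
    (∃ i, leadExp a i ≤ α) ↔ LeadDvd a (α 1) (α 2) (α 3) := by
  simp [Fin.exists_fin_succ, leadExp, quadExp_le_iff, LeadDvd]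

lemma leadExp_apply_zero (a : Exponents) (i : Fin 6) : leadExp a i 0 = 0 := by
  fin_cases i <;> rfl

variable {K : Type*} [Field K] {a : Exponents} {n : Fin 4 → ℕ}

lemma ExponentRelations.expWeight_leadExp (E : ExponentRelations a n) (hle : a.a13 ≤ a.a23)
    (i : Fin 6) : expWeight n (leadExp a i) = expWeight n (tailExp a i) := by
  have e1 := E.e1
  have e2 := E.e2
  have e3 := E.e3
  have e4 := E.e4
  have e5 := E.e5
  obtain ⟨t, ht⟩ := Nat.exists_eq_add_of_le hle
  have ht' : a.a23 - a.a13 = t := by omega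
  have e2' := e2
  rw [ht] at e2'
  fin_cases i <;>
    simp [expWeight_eq_quadWeight, quadWeight, leadExp, tailExp, ht'] <;> linarith

/-- When the degrees agree, the tail contains `x_1` and the leading monomial does not; as `x_1` is
the smallest variable, this decides the order. -/
lemma DegreeInequalities.degree_leadExp (D : DegreeInequalities a) (E : ExponentRelations a n)
    (i : Fin 6) : (leadExp a i).degree < (tailExp a i).degree ∨
      ((leadExp a i).degree = (tailExp a i).degree ∧ 0 < tailExp a i 0) := by
  have := D.d1
  have := D.d2
  have := D.d3
  have := D.d4
  have := D.d5
  have := D.d6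
  have := E.h31
  have := E.h41
  fin_cases i <;> simp [quadExp_degree, leadExp, tailExp] <;> omega

lemma DegreeInequalities.leadExp_ne_tailExp (D : DegreeInequalities a)
    (E : ExponentRelations a n) (i : Fin 6) : leadExp a i ≠ tailExp a i := by
  intro h
  have h1 := D.degree_leadExp E i
  have h2 := leadExp_apply_zero a i
  rw [h] at h1 h2
  omega

lemma DegreeInequalities.negDegRevLexGT (D : DegreeInequalities a)
    (E : ExponentRelations a n) (i : Fin 6) : NegDegRevLexGT (leadExp a i) (tailExp a i) := by
  rcases D.degree_leadExp E i with h | ⟨h, h0⟩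
  · exact .inl h
  · exact .inr ⟨h, 0, fun j hj => absurd hj (Fin.not_lt_zero j), by rwa [leadExp_apply_zero]⟩

variable (K a n) in
/-- `β` is reached from `α` by reductions by `f_1, …, f_6`: the relation records the effect on the
degree and on the exponent of `x_1`, and the congruence modulo the initial forms. -/
def ReducesTo (α β : Fin 4 →₀ ℕ) : Prop :=
  expWeight n β = expWeight n α ∧
    ((α.degree < β.degree ∧
        monomial α (1 : K) ∈ Ideal.span (Set.range (initialForm K a))) ∨
      (α.degree = β.degree ∧ (β = α ∨ α 0 < β 0) ∧
        monomial α (1 : K) - monomial β 1 ∈ Ideal.span (Set.range (initialForm K a))))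

lemma ReducesTo.refl (α : Fin 4 →₀ ℕ) : ReducesTo K a n α α :=
  ⟨rfl, .inr ⟨rfl, .inl rfl, by simp⟩⟩

lemma ReducesTo.trans {α β γ : Fin 4 →₀ ℕ} (h1 : ReducesTo K a n α β)
    (h2 : ReducesTo K a n β γ) : ReducesTo K a n α γ := by
  obtain ⟨w1, h1⟩ := h1
  obtain ⟨w2, h2⟩ := h2
  refine ⟨w2.trans w1, ?_⟩
  rcases h1 with ⟨l1, m1⟩ | ⟨l1, x1, m1⟩
  · refine .inl ⟨?_, m1⟩
    rcases h2 with ⟨l2, -⟩ | ⟨l2, -⟩ <;> omega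
  · rcases h2 with ⟨l2, m2⟩ | ⟨l2, x2, m2⟩
    · exact .inl ⟨l1.trans_lt l2, by simpa using add_mem m1 m2⟩
    · refine .inr ⟨l1.trans l2, ?_, by simpa using add_mem m1 m2⟩
      rcases x1 with rfl | x1
      · exact x2
      · rcases x2 with rfl | x2
        exacts [.inr x1, .inr (x1.trans x2)]

lemma degree_le_expWeight {d : ℕ} {n : Fin d → ℕ} (hpos : ∀ i, 0 < n i) (α : Fin d →₀ ℕ) :
    α.degree ≤ expWeight n α := by
  rw [Finsupp.degree_eq_sum]
  exact Finset.sum_le_sum fun i _ => Nat.le_mul_of_pos_left _ (hpos i)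

lemma apply_le_degree {d : ℕ} (α : Fin d →₀ ℕ) (i : Fin d) : α i ≤ α.degree := by
  rw [Finsupp.degree_eq_sum]
  exact Finset.single_le_sum (f := fun j => α j) (fun _ _ => Nat.zero_le _) (Finset.mem_univ i)

section

variable (E : ExponentRelations a n) (hle : a.a13 ≤ a.a23)
include E hle

lemma eq_of_expWeight_eq {α β : Fin 4 →₀ ℕ} (hw : expWeight n α = expWeight n β)
    (hα : ¬ LeadDvd a (α 1) (α 2) (α 3)) (hβ : ¬ LeadDvd a (β 1) (β 2) (β 3)) : α = β := by
  rw [expWeight_eq_quadWeight, expWeight_eq_quadWeight] at hw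
  exact (exp_ext_iff α β).mpr (E.eq_of_not_leadDvd hle hw hα hβ)

variable (D : DegreeInequalities a)
include D

lemma reducesTo_sub_add {α : Fin 4 →₀ ℕ} {i : Fin 6} (hi : leadExp a i ≤ α) :
    ReducesTo K a n α (α - leadExp a i + tailExp a i) ∧
      α.degree + α 0 < (α - leadExp a i + tailExp a i).degree +
        (α - leadExp a i + tailExp a i) 0 := by
  obtain ⟨γ, rfl⟩ := exists_add_of_le hi
  have hw := E.expWeight_leadExp hle i
  have hd := D.degree_leadExp E i
  have h0 := leadExp_apply_zero a i
  have hmem : initialForm K a i ∈ Ideal.span (Set.range (initialForm K a)) :=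
    Ideal.subset_span ⟨i, rfl⟩
  have hmem' := Ideal.mul_mem_left _ (monomial γ 1) hmem
  rw [add_tsub_cancel_left]
  simp only [map_add, Finsupp.add_apply]
  refine ⟨⟨by rw [expWeight_add, expWeight_add, hw, add_comm], ?_⟩, by omega⟩
  rcases hd with hd | ⟨hd, hd0⟩
  · left
    simp only [map_add]
    refine ⟨by omega, ?_⟩
    rwa [initialForm, if_neg hd.ne, monomial_mul, mul_one, add_comm γ] at hmem'
  · right
    simp only [map_add, Finsupp.add_apply]
    refine ⟨by omega, .inr (by omega), ?_⟩
    rwa [initialForm, if_pos hd, mul_sub, monomial_mul, monomial_mul, mul_one,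
      add_comm γ (leadExp a i)] at hmem'

/-- A local ordering alone does not make rewriting terminate. Here the weight is constant and bounds
the degree, which bounds the exponent of `x_1`, so the sum of these two, strictly increasing by
`reducesTo_sub_add`, stays at most twice the weight. -/
lemma exists_reducesTo_not_leadDvd (α : Fin 4 →₀ ℕ) :
    ∃ β, ReducesTo K a n α β ∧ ¬ LeadDvd a (β 1) (β 2) (β 3) := by
  induction hm : 2 * expWeight n α - (α.degree + α 0) using Nat.strong_induction_on
    generalizing α with
  | _ m ih =>
  by_cases hα : LeadDvd a (α 1) (α 2) (α 3)
  · obtain ⟨i, hi⟩ := (exists_leadExp_le_iff a α).mpr hα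
    obtain ⟨h1, h2⟩ := reducesTo_sub_add (K := K) E hle D hi
    set β := α - leadExp a i + tailExp a i
    have hb1 := degree_le_expWeight E.npos β
    have hb2 := apply_le_degree β 0
    have hb3 := h1.1
    obtain ⟨γ, h3, h4⟩ := ih _ (by omega) β rfl
    exact ⟨γ, h1.trans h3, h4⟩
  · exact ⟨α, .refl α, hα⟩

/-- The leading monomial of an element of the toric ideal is divisible by one of the `leadExp`. -/
lemma leadDvd_of_isLeadingExponent {f : MvPolynomial (Fin 4) K} (hf : f ∈ toricIdeal K n)
    {α : Fin 4 →₀ ℕ} (hα : IsLeadingExponent NegDegRevLexGT f α) :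
    LeadDvd a (α 1) (α 2) (α 3) := by
  by_contra hL
  obtain ⟨β, hβ, hne, hw⟩ := exists_ne_expWeight_eq hf hα.1
  obtain ⟨γ, ⟨hγw, hγ⟩, hγL⟩ := exists_reducesTo_not_leadDvd (K := K) E hle D β
  -- The normal form of `β` is `α` itself, so `α` is below `β` in the ordering, against its being
  -- the leading exponent.
  obtain rfl := eq_of_expWeight_eq E hle (hγw.trans hw) hγL hL
  have hgt := hα.2 β hβ hne
  rcases hγ with ⟨h1, -⟩ | ⟨h1, h2, -⟩
  · rcases hgt with h | ⟨h, -⟩ <;> omega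
  · rcases h2 with rfl | h2
    · exact hne rfl
    · rcases hgt with h | ⟨-, i, hi, hlt⟩
      · omega
      · rcases (Fin.zero_le i).eq_or_lt with rfl | hpos
        · omega
        · have := hi 0 hpos
          omega

/-- The set `{f_1, …, f_6}` is a standard basis. -/
lemma isStandardBasis :
    IsStandardBasis NegDegRevLexGT {f1 K a, f2 K a, f3 K a, f4 K a, f5 K a, f6 K a}
      (toricIdeal K n) := by
  have hmem : ∀ i, monomial (leadExp a i) (1 : K) - monomial (tailExp a i) 1 ∈
      toricIdeal K n := fun i =>
    monomial_sub_monomial_mem_toricIdeal (E.expWeight_leadExp hle i)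
  have hlead : ∀ i, IsLeadingExponent NegDegRevLexGT
      (monomial (leadExp a i) (1 : K) - monomial (tailExp a i) 1) (leadExp a i) := fun i =>
    isLeadingExponent_monomial_sub_monomial (D.leadExp_ne_tailExp E i) (D.negDegRevLexGT E i)
  have g1 : f1 K a = -(monomial (leadExp a 0) (1 : K) - monomial (tailExp a 0) 1) := by
    rw [f1_eq, neg_sub]; rfl
  have g2 : f2 K a = -(monomial (leadExp a 1) (1 : K) - monomial (tailExp a 1) 1) := by
    rw [f2_eq, neg_sub]; rfl
  have g3 : f3 K a = monomial (leadExp a 2) (1 : K) - monomial (tailExp a 2) 1 := f3_eq K a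
  have g4 : f4 K a = monomial (leadExp a 3) (1 : K) - monomial (tailExp a 3) 1 := f4_eq K a
  have g5 : f5 K a = -(monomial (leadExp a 4) (1 : K) - monomial (tailExp a 4) 1) := by
    rw [f5_eq, neg_sub]; rfl
  have g6 : f6 K a = monomial (leadExp a 5) (1 : K) - monomial (tailExp a 5) 1 := f6_eq K a
  have hsub : {f1 K a, f2 K a, f3 K a, f4 K a, f5 K a, f6 K a} ⊆
      (toricIdeal K n : Set (MvPolynomial (Fin 4) K)) := by
    rintro f (rfl | rfl | rfl | rfl | rfl | rfl)
    · rw [g1]; exact neg_mem (hmem 0)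
    · rw [g2]; exact neg_mem (hmem 1)
    · rw [g3]; exact hmem 2
    · rw [g4]; exact hmem 3
    · rw [g5]; exact neg_mem (hmem 4)
    · rw [g6]; exact hmem 5
  have hG : ∀ i, ∃ f ∈ ({f1 K a, f2 K a, f3 K a, f4 K a, f5 K a, f6 K a} :
      Set (MvPolynomial (Fin 4) K)), IsLeadingExponent NegDegRevLexGT f (leadExp a i) := by
    intro i
    fin_cases i
    · exact ⟨f1 K a, by simp, by rw [g1]; exact (hlead 0).neg⟩
    · exact ⟨f2 K a, by simp, by rw [g2]; exact (hlead 1).neg⟩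
    · exact ⟨f3 K a, by simp, by rw [g3]; exact hlead 2⟩
    · exact ⟨f4 K a, by simp, by rw [g4]; exact hlead 3⟩
    · exact ⟨f5 K a, by simp, by rw [g5]; exact (hlead 4).neg⟩
    · exact ⟨f6 K a, by simp, by rw [g6]; exact hlead 5⟩
  refine ⟨Set.toFinite _, hsub, le_antisymm (Ideal.span_mono ?_) ?_⟩
  · rintro p ⟨f, hf, α, hα⟩
    exact ⟨f, hsub hf, α, hα⟩
  · rw [leadingIdeal, Ideal.span_le]
    rintro _ ⟨f, hf, α, hα, rfl⟩
    obtain ⟨i, hi⟩ := (exists_leadExp_le_iff a α).mpr (leadDvd_of_isLeadingExponent E hle D hf hα)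
    obtain ⟨γ, rfl⟩ := exists_add_of_le hi
    obtain ⟨g, hg, hgi⟩ := hG i
    have : monomial (leadExp a i + γ) (1 : K) = monomial γ 1 * monomial (leadExp a i) 1 := by
      rw [monomial_mul, mul_one, add_comm]
    rw [this]
    exact Ideal.mul_mem_left _ _ (Ideal.subset_span ⟨g, hg, _, hgi, rfl⟩)

/-- The initial forms of `f_1, …, f_6` generate the ideal of least forms. -/
lemma span_initialForm :
    Ideal.span (Set.range (initialForm K a)) = leastFormIdeal (toricIdeal K n) := by
  classical
  apply le_antisymm
  · rw [Ideal.span_le]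
    rintro _ ⟨i, rfl⟩
    have := leastForm_mem_leastFormIdeal
      (monomial_sub_monomial_mem_toricIdeal (K := K) (E.expWeight_leadExp hle i))
    rw [initialForm]
    rcases D.degree_leadExp E i with h | ⟨h, -⟩
    · rwa [if_neg h.ne, ← leastForm_monomial_sub_monomial_of_lt h]
    · rwa [if_pos h, ← leastForm_monomial_sub_monomial_of_eq (D.leadExp_ne_tailExp E i) h]
  · rw [leastFormIdeal, Ideal.span_le]
    rintro _ ⟨f, hf, rfl⟩
    obtain ⟨k, hk, hkle⟩ := exists_leastForm_eq f
    choose b hb hbL using exists_reducesTo_not_leadDvd (K := K) E hle D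
    have hbw : ∀ α β, expWeight n α = expWeight n β → b α = b β := fun α β h =>
      eq_of_expWeight_eq E hle (by rw [(hb α).1, (hb β).1, h]) (hbL α) (hbL β)
    -- `ψ m` is the standard monomial of weight `m` if it has degree `k`, and `0` otherwise. It
    -- depends on the weight only, so its sum over the terms of `f` vanishes and may be subtracted
    -- from the least form, leaving a termwise check.
    let ψ : ℕ → MvPolynomial (Fin 4) K := fun m =>
      if h : ∃ α, expWeight n α = m then
        if (b h.choose).degree = k then monomial (b h.choose) 1 else 0 else 0
    have hψ : ∀ α, ψ (expWeight n α) =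
        if (b α).degree = k then monomial (b α) 1 else 0 := by
      intro α
      have h : ∃ β, expWeight n β = expWeight n α := ⟨α, rfl⟩
      simp only [ψ, dif_pos h, hbw _ _ h.choose_spec]
    have hsum := sum_smul_expWeight_eq_zero hf ψ
    have hleast : leastForm f = ∑ α ∈ f.support, coeff α f •
        (if α.degree = k then monomial α (1 : K) else 0) := by
      rw [hk]
      ext β
      rw [coeff_homogeneousComponent, coeff_sum]
      by_cases hβ : β ∈ f.support
      · rw [Finset.sum_eq_single_of_mem β hβ]
        · split_ifs <;> simp
        · intro γ _ hγ
          split_ifs <;> simp [hγ]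
      · rw [notMem_support_iff.mp hβ, ite_self]
        refine (Finset.sum_eq_zero fun γ hγ => ?_).symm
        have : γ ≠ β := fun h => hβ (h ▸ hγ)
        split_ifs <;> simp [this]
    have hdiff : leastForm f = ∑ α ∈ f.support, (coeff α f •
        (if α.degree = k then monomial α (1 : K) else 0) -
          coeff α f • ψ (expWeight n α)) := by
      rw [Finset.sum_sub_distrib, hsum, sub_zero, hleast]
    rw [SetLike.mem_coe, hdiff]
    refine sum_mem fun α hα => ?_
    rw [← smul_sub, hψ, smul_eq_C_mul]
    refine Ideal.mul_mem_left _ _ ?_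
    have hkα := hkle α hα
    rcases (hb α).2 with ⟨h1, h2⟩ | ⟨h1, -, h2⟩
    · rw [if_neg (by omega : (b α).degree ≠ k), sub_zero]
      split_ifs
      exacts [h2, zero_mem _]
    · rw [← h1]
      split_ifs
      exacts [h2, by simp]

/-- None of the initial forms is redundant. -/
lemma isMinimallyGeneratedBy_initialForm :
    IsMinimallyGeneratedBy (leastFormIdeal (toricIdeal K n)) (initialForm K a) := by
  refine ⟨span_initialForm E hle D, fun i hi => ?_⟩
  -- The forms other than the `i`-th involve only monomials not dividing the `i`-th leading
  -- monomial. This property passes to multiples, hence to the ideal they generate, but fails for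
  -- the `i`-th form.
  have hup : IsUpperSet {α : Fin 4 →₀ ℕ | ¬ α ≤ leadExp a i} := fun α β hαβ hα hβ =>
    hα (hαβ.trans hβ)
  have hlead : ∀ j, j ≠ i → ¬ leadExp a j ≤ leadExp a i := by
    have := E.h12
    have := E.h13
    have := E.h23
    have := E.h24
    have := E.h34
    intro j hj
    fin_cases i <;> fin_cases j <;> simp [leadExp, quadExp_le_iff] at hj ⊢ <;> omega
  have htail : ∀ j, (leadExp a j).degree = (tailExp a j).degree →
      ¬ tailExp a j ≤ leadExp a i := by
    intro j hj h
    have h1 := D.degree_leadExp E j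
    have h2 := h 0
    rw [leadExp_apply_zero] at h2
    omega
  have hle' : Ideal.span (initialForm K a '' {j | j ≠ i}) ≤ restrictSupportIdeal K _ hup := by
    rw [Ideal.span_le]
    rintro _ ⟨j, hj, rfl⟩
    rw [initialForm]
    split_ifs with h
    · intro γ hγ
      rcases (mem_support_monomial_sub_monomial (D.leadExp_ne_tailExp E j)).mp hγ with rfl | rfl
      exacts [hlead j hj, htail j h]
    · intro γ hγ
      obtain rfl := Finset.mem_singleton.mp (support_monomial_subset hγ)
      exact hlead j hj
  refine mem_restrictSupportIdeal.mp (hle' hi) (leadExp a i) ?_ le_rfl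
  rw [initialForm]
  split_ifs with h
  · exact (mem_support_monomial_sub_monomial (D.leadExp_ne_tailExp E i)).mpr (.inl rfl)
  · classical
    rw [mem_support_iff, coeff_monomial, if_pos rfl]
    exact one_ne_zero

end

end MonomialCurve

/-! ### Consequences of Cohen-Macaulayness: `x_1` is a nonzerodivisor -/

namespace MonomialCurve

open MvPolynomial

/-- Over a Cohen-Macaulay local ring `R_m` of positive dimension, no nonzero element of `R` is
annihilated by a power of `m`. -/
lemma eq_zero_of_forall_mem_pow_mul_eq_zero {R : Type*} [CommRing R] (m : Ideal R) [m.IsMaximal]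
    (h : IsCohenMacaulayLocalRing (Localization.AtPrime m))
    (hdim : ringKrullDim (Localization.AtPrime m) ≠ 0) {g : R} {N : ℕ}
    (hN : ∀ y ∈ m ^ N, y * g = 0) : g = 0 := by
  obtain ⟨-, rs, hrs, hreg, hlen⟩ := h
  cases rs with
  | nil => exact absurd hlen.symm (by simpa using hdim)
  | cons r rs =>
    have hr : IsSMulRegular (Localization.AtPrime m) r :=
      ((RingTheory.Sequence.isWeaklyRegular_cons_iff _ _ _).mp hreg.toIsWeaklyRegular).1
    have hpow : r ^ N ∈ (m ^ N).map (algebraMap R (Localization.AtPrime m)) := by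
      rw [Ideal.map_pow, Localization.AtPrime.map_eq_maximalIdeal]
      exact Ideal.pow_mem_pow (hrs r (by simp)) N
    have hann : (m ^ N).map (algebraMap R (Localization.AtPrime m)) ≤
        (Ideal.span {algebraMap R (Localization.AtPrime m) g}).annihilator := by
      rw [Ideal.map_le_iff_le_comap]
      intro y hy
      rw [Ideal.mem_comap, Ideal.span, Submodule.mem_annihilator_span_singleton, smul_eq_mul,
        ← map_mul, hN y hy, map_zero]
    have hzero : r ^ N • algebraMap R (Localization.AtPrime m) g = 0 :=
      (Submodule.mem_annihilator_span_singleton _ _).mp (hann hpow)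
    have hg0 : algebraMap R (Localization.AtPrime m) g = 0 :=
      (hr.pow N) (by simpa using hzero)
    obtain ⟨⟨u, hu⟩, hug⟩ := (IsLocalization.map_eq_zero_iff m.primeCompl _ g).mp hg0
    by_contra hg
    have htop : (Ideal.span {g}).annihilator ≠ ⊤ := by
      intro htop
      have h1 : (1 : R) ∈ (Ideal.span {g}).annihilator := htop ▸ Submodule.mem_top
      exact hg (by simpa using (Submodule.mem_annihilator_span_singleton _ _).mp h1)
    -- The annihilator of `g` contains `m ^ N` and an element `u` outside `m`. A maximal ideal above
    -- it would have to be `m`, which excludes `u`.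
    obtain ⟨M, hM, hle⟩ := Ideal.exists_le_maximal _ htop
    have hmM : m ≤ M := Ideal.IsPrime.le_of_pow_le (n := N) fun y hy =>
      hle ((Submodule.mem_annihilator_span_singleton _ _).mpr (hN y hy))
    obtain rfl := Ideal.IsMaximal.eq_of_le ‹m.IsMaximal› hM.ne_top hmM
    exact hu (hle ((Submodule.mem_annihilator_span_singleton _ _).mpr hug))

lemma ringKrullDim_localization_ne_zero {R : Type*} [CommRing R] {m P : Ideal R} [m.IsPrime]
    (hP : P.IsPrime) (hlt : P < m) : ringKrullDim (Localization.AtPrime m) ≠ 0 := by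
  rw [IsLocalization.AtPrime.ringKrullDim_eq_height m]
  intro h
  have h0 : m.height = 0 := by exact_mod_cast h
  exact hlt.not_ge ((Ideal.height_eq_zero_iff.mp h0).2 ⟨hP, bot_le⟩ hlt.le)

variable {K : Type*} [Field K] {n : Fin 4 → ℕ}

lemma expWeight_single {d : ℕ} (n : Fin d → ℕ) (i : Fin d) (k : ℕ) :
    expWeight n (Finsupp.single i k) = n i * k := by
  rw [expWeight, Finset.sum_eq_single_of_mem i (Finset.mem_univ i)]
  · simp
  · intro j _ hj
    simp [Finsupp.single_eq_of_ne hj]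

/-- Powers of the variables other than `x_1` are least forms. -/
lemma X_pow_mem_leastFormIdeal (hn : StrictMono n) {i : Fin 4} (hi : 0 < i) :
    (X i : MvPolynomial (Fin 4) K) ^ n 0 ∈ leastFormIdeal (toricIdeal K n) := by
  have hmem : monomial (Finsupp.single i (n 0)) (1 : K) -
      monomial (Finsupp.single 0 (n i)) 1 ∈ toricIdeal K n :=
    monomial_sub_monomial_mem_toricIdeal (by
      rw [expWeight_single, expWeight_single, mul_comm])
  have := leastForm_mem_leastFormIdeal hmem
  rw [leastForm_monomial_sub_monomial_of_lt (by simpa using hn hi)] at this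
  rwa [X_pow_eq_monomial]

/-- The tangent cone contains the line on which all variables but `x_1` vanish. -/
lemma leastFormIdeal_le_ker (hpos : 0 < n 0) (hn : StrictMono n) :
    leastFormIdeal (toricIdeal K n) ≤ RingHom.ker
      (aeval ![Polynomial.X, 0, 0, 0] : MvPolynomial (Fin 4) K →ₐ[K] Polynomial K) := by
  rw [leastFormIdeal, Ideal.span_le]
  rintro _ ⟨f, hf, rfl⟩
  rw [SetLike.mem_coe, RingHom.mem_ker, (leastForm f).as_sum, map_sum]
  refine Finset.sum_eq_zero fun α hα => ?_
  suffices h : ¬ (α 1 = 0 ∧ α 2 = 0 ∧ α 3 = 0) by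
    rw [aeval_monomial, Finsupp.prod_fintype _ _ (by simp), Fin.prod_univ_four]
    by_cases h1 : α 1 = 0
    · by_cases h2 : α 2 = 0
      · have h3 : α 3 ≠ 0 := fun h3 => h ⟨h1, h2, h3⟩
        simp [h3]
      · simp [h2]
    · simp [h1]
  rintro ⟨h1, h2, h3⟩
  obtain ⟨k, hk, hkle⟩ := exists_leastForm_eq f
  have hdeg : α.degree = k := by
    rw [hk, mem_support_iff, coeff_homogeneousComponent] at hα
    by_contra hne
    exact hα (if_neg hne)
  obtain ⟨β, hβ, hne, hw⟩ := exists_ne_expWeight_eq hf (support_leastForm_subset f hα)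
  have hβdeg := hkle β hβ
  rw [← hdeg] at hβdeg
  simp only [expWeight_eq_quadWeight, quadWeight, h1, h2, h3, Finsupp.degree_eq_sum,
    Fin.sum_univ_four, mul_zero, add_zero] at hw hβdeg
  -- A cancelling monomial `β` has the weight of a pure power of `x_1` and at least its degree. As
  -- `n_1` is the strictly smallest weight, `β` must be the same power of `x_1`.
  have g1 := Nat.mul_le_mul_right (β 1) (Nat.succ_le_of_lt (hn (show (0 : Fin 4) < 1 by decide)))
  have g2 := Nat.mul_le_mul_right (β 2) (Nat.succ_le_of_lt (hn (show (0 : Fin 4) < 2 by decide)))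
  have g3 := Nat.mul_le_mul_right (β 3) (Nat.succ_le_of_lt (hn (show (0 : Fin 4) < 3 by decide)))
  have g0 := Nat.mul_le_mul_left (n 0) hβdeg
  simp only [Nat.succ_eq_add_one] at g1 g2 g3
  have hsum : β 1 + β 2 + β 3 = 0 := by nlinarith
  have h0 : β 0 = α 0 := by
    apply Nat.eq_of_mul_eq_mul_left hpos
    simpa [show β 1 = 0 by omega, show β 2 = 0 by omega, show β 3 = 0 by omega] using hw
  exact hne ((exp_ext_iff β α).mpr ⟨h0, by omega, by omega, by omega⟩)

/-- If the tangent cone is Cohen-Macaulay, then `x_1` is a nonzerodivisor on its coordinate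
ring. -/
lemma mem_leastFormIdeal_of_X_zero_mul_mem (hpos : 0 < n 0) (hn : StrictMono n)
    (hCM : HasCohenMacaulayTangentCone K n) {g : MvPolynomial (Fin 4) K}
    (hg : X 0 * g ∈ leastFormIdeal (toricIdeal K n)) :
    g ∈ leastFormIdeal (toricIdeal K n) := by
  obtain ⟨hnoeth, hloc⟩ := hCM
  set J := leastFormIdeal (toricIdeal K n)
  let φ : MvPolynomial (Fin 4) K ⧸ J →+* Polynomial K :=
    Ideal.Quotient.lift J (aeval ![Polynomial.X, 0, 0, 0] :
      MvPolynomial (Fin 4) K →ₐ[K] Polynomial K).toRingHom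
      fun f hf => leastFormIdeal_le_ker hpos hn hf
  have hφ : ∀ f, φ (Ideal.Quotient.mk J f) = aeval ![Polynomial.X, 0, 0, 0] f := fun f => rfl
  let ε : MvPolynomial (Fin 4) K ⧸ J →+* K := (Polynomial.evalRingHom 0).comp φ
  have hε : ∀ f, ε (Ideal.Quotient.mk J f) = constantCoeff f := by
    intro f
    have : (Polynomial.evalRingHom (0 : K)).comp (aeval ![Polynomial.X, 0, 0, 0] :
        MvPolynomial (Fin 4) K →ₐ[K] Polynomial K).toRingHom = constantCoeff := by
      apply MvPolynomial.ringHom_ext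
      · intro r; simp
      · intro i; fin_cases i <;> simp
    exact DFunLike.congr_fun this f
  have hsurj : Function.Surjective ε := fun c =>
    ⟨Ideal.Quotient.mk J (C c), by rw [hε, constantCoeff_C]⟩
  let m := RingHom.ker ε
  have hm : m.IsMaximal := RingHom.ker_isMaximal_of_surjective ε hsurj
  -- The `x_1`-axis lies in the tangent cone, so the local ring at the origin has positive
  -- dimension.
  have hPm : RingHom.ker φ < m := by
    refine lt_of_le_of_ne (fun y hy => ?_) fun heq => ?_
    · have hy' : φ y = 0 := hy
      change (Polynomial.evalRingHom 0) (φ y) = 0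
      rw [hy', map_zero]
    · have hX : Ideal.Quotient.mk J (X 0) ∈ RingHom.ker φ := by
        rw [heq]
        change ε _ = 0
        rw [hε, constantCoeff_X]
      rw [RingHom.mem_ker, hφ, aeval_X] at hX
      exact Polynomial.X_ne_zero hX
  have hdim := ringKrullDim_localization_ne_zero (RingHom.ker_isPrime φ) hPm
  -- Modulo `J` the element `x_1` kills `g` and the other variables are nilpotent, so a power of `m`
  -- kills `g`.
  have hrad : m ≤ (Ideal.span {Ideal.Quotient.mk J g}).annihilator.radical := by
    intro y hy
    obtain ⟨f, rfl⟩ := Ideal.Quotient.mk_surjective y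
    have hf : constantCoeff f = 0 := by rw [← hε]; exact hy
    have hfX : f ∈ idealOfVars (Fin 4) K := by
      rw [idealOfVars_eq_restrictSupportIdeal]
      intro α hα
      change 1 ≤ α.degree
      by_contra h0
      have hα0 : α = 0 := (Finsupp.degree_eq_zero_iff α).mp (by omega)
      subst hα0
      exact mem_support_iff.mp hα hf
    have hle : idealOfVars (Fin 4) K ≤
        (Ideal.span {Ideal.Quotient.mk J g}).annihilator.radical.comap (Ideal.Quotient.mk J) := by
      rw [idealOfVars, Ideal.span_le]
      rintro _ ⟨i, rfl⟩
      rcases (Fin.zero_le i).eq_or_lt with rfl | hi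
      · refine ⟨1, (Submodule.mem_annihilator_span_singleton _ _).mpr ?_⟩
        rw [pow_one, smul_eq_mul, ← map_mul]
        exact Ideal.Quotient.eq_zero_iff_mem.mpr hg
      · refine ⟨n 0, ?_⟩
        rw [← map_pow, Ideal.Quotient.eq_zero_iff_mem.mpr (X_pow_mem_leastFormIdeal hn hi)]
        exact zero_mem _
    exact hle hfX
  obtain ⟨N, hN⟩ := Ideal.exists_pow_le_of_le_radical_of_fg hrad (IsNoetherian.noetherian m)
  refine Ideal.Quotient.eq_zero_iff_mem.mp
    (eq_zero_of_forall_mem_pow_mul_eq_zero m (hloc m) hdim (N := N) fun y hy => ?_)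
  exact (Submodule.mem_annihilator_span_singleton _ _).mp (hN hy)

variable {a : Exponents}

/-- The inequalities between the degrees of the monomials of the `f_i` forced by a Cohen-Macaulay
tangent cone. -/
lemma IsCase2a.degreeInequalities (ha : IsCase2a K a n) (E : ExponentRelations a n)
    (hn : StrictMono n) (hCM : HasCohenMacaulayTangentCone K n) (hle : a.a13 ≤ a.a23) :
    DegreeInequalities a := by
  have n01 := hn (show (0 : Fin 4) < 1 by decide)
  have n12 := hn (show (1 : Fin 4) < 2 by decide)
  have n23 := hn (show (2 : Fin 4) < 3 by decide)
  have h12 := E.h12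
  have h13 := E.h13
  have h23 := E.h23
  have h24 := E.h24
  have h31 := E.h31
  have h34 := E.h34
  have h41 := E.h41
  have h42 := E.h42
  -- a least form divisible by `x_1` stays in the ideal after cancelling `x_1`
  have cancel : ∀ i p r s, tailExp a i = quadExp p 0 r s →
      (tailExp a i).degree < (leadExp a i).degree → OccursDvd a 0 0 r s := by
    intro i p r s hi hlt
    have hmem := leastForm_mem_leastFormIdeal
      (monomial_sub_monomial_mem_toricIdeal (K := K) (E.expWeight_leadExp hle i).symm)
    rw [leastForm_monomial_sub_monomial_of_lt hlt, hi] at hmem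
    have hred : ∀ p, monomial (quadExp p 0 r s) (1 : K) ∈ leastFormIdeal (toricIdeal K n) →
        monomial (quadExp 0 0 r s) (1 : K) ∈ leastFormIdeal (toricIdeal K n) := by
      intro p
      induction p with
      | zero => exact id
      | succ p ih =>
        intro h
        refine ih (mem_leastFormIdeal_of_X_zero_mul_mem (E.npos 0) hn hCM ?_)
        rw [monomial_quadExp] at h ⊢
        convert h using 1
        simp only [x1]
        ring
    refine mem_restrictSupportIdeal.mp
      (leastFormIdeal_le_restrictSupportIdeal ha.toricIdeal_le (hred p hmem)) (quadExp 0 0 r s) ?_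
    exact (mem_support_iff.mpr (by
      classical rw [coeff_monomial, if_pos rfl]; exact one_ne_zero))
  -- `d1`, `d2`, `d4` compare weights using the monotonicity of `n`. If `d3`, `d5` or `d6` failed,
  -- `cancel` would apply to `x_4 ^ a_34`, `x_3 ^ a_23` or `x_3 ^ (a_23 - a_13) x_4 ^ a_24`, none
  -- divisible by any of the ten monomials.
  refine ⟨?_, ?_, ?_, ?_, ?_, ?_⟩
  · by_contra! h
    have := Nat.mul_le_mul_left (n 0) h
    nlinarith [E.e1, Nat.mul_lt_mul_of_pos_right n01 h12.1,
      Nat.mul_lt_mul_of_pos_right (n01.trans n12) h13.1]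
  · by_contra! h
    have := Nat.mul_le_mul_left (n 1) h
    nlinarith [E.e2, Nat.mul_lt_mul_of_pos_right n12 h23.1,
      Nat.mul_lt_mul_of_pos_right (n12.trans n23) h24.1]
  · by_contra! h
    have := cancel 2 a.a31 0 a.a34 rfl (by simp [leadExp, tailExp, quadExp_degree]; omega)
    unfold OccursDvd at this
    omega
  · by_contra! h
    have := Nat.mul_le_mul_left (n 3) h
    nlinarith [E.e4, Nat.mul_lt_mul_of_pos_right ((n01.trans n12).trans n23) h41.1,
      Nat.mul_lt_mul_of_pos_right (n12.trans n23) h42.1]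
  · by_contra! h
    have := cancel 4 a.a41 a.a23 0 rfl (by simp [leadExp, tailExp, quadExp_degree]; omega)
    unfold OccursDvd at this
    omega
  · by_contra! h
    have := cancel 5 a.a1 (a.a23 - a.a13) a.a24 rfl
      (by simp [leadExp, tailExp, quadExp_degree]; omega)
    unfold OccursDvd at this
    omega

end MonomialCurve

/-! ### Explicit initial forms and the eight cases -/

namespace MonomialCurve

open MvPolynomial

section

variable (K : Type*) [Field K] (a : Exponents)

/-- The least form of `f_3` up to sign. -/
lemma initialForm_two : initialForm K a 2 = if a.a3 = a.a31 + a.a34 then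
    x3 K ^ a.a3 - x1 K ^ a.a31 * x4 K ^ a.a34 else x3 K ^ a.a3 := by
  simp [initialForm, leadExp, tailExp, quadExp_degree, monomial_quadExp]

/-- The least form of `f_5` up to sign. -/
lemma initialForm_four : initialForm K a 4 = if a.a12 + a.a34 = a.a41 + a.a23 then
    x2 K ^ a.a12 * x4 K ^ a.a34 - x1 K ^ a.a41 * x3 K ^ a.a23
      else x2 K ^ a.a12 * x4 K ^ a.a34 := by
  simp [initialForm, leadExp, tailExp, quadExp_degree, monomial_quadExp]

/-- The least form of `f_6` up to sign. -/
lemma initialForm_five : initialForm K a 5 =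
    if a.a2 + a.a12 = a.a1 + a.a24 + (a.a23 - a.a13) then
      x2 K ^ (a.a2 + a.a12) - x1 K ^ a.a1 * x3 K ^ (a.a23 - a.a13) * x4 K ^ a.a24
    else x2 K ^ (a.a2 + a.a12) := by
  rw [add_right_comm a.a1]
  simp [initialForm, leadExp, tailExp, quadExp_degree, monomial_quadExp]

variable {a} (D : DegreeInequalities a)
include D

lemma initialForm_zero : initialForm K a 0 = x2 K ^ a.a12 * x3 K ^ a.a13 := by
  simp [initialForm, leadExp, tailExp, quadExp_degree, monomial_quadExp, D.d1.ne]

lemma initialForm_one : initialForm K a 1 = x3 K ^ a.a23 * x4 K ^ a.a24 := by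
  simp [initialForm, leadExp, tailExp, quadExp_degree, monomial_quadExp, D.d2.ne]

lemma initialForm_three : initialForm K a 3 = x4 K ^ a.a4 := by
  simp [initialForm, leadExp, tailExp, quadExp_degree, monomial_quadExp, D.d4.ne]

end

/-- The initial forms may be listed with either sign. -/
lemma DegreeInequalities.isMinimallyGeneratedBy {K : Type*} [Field K] {a : Exponents}
    (D : DegreeInequalities a) {I : Ideal (MvPolynomial (Fin 4) K)}
    (h : IsMinimallyGeneratedBy I (initialForm K a)) {g3 g5 g6 : MvPolynomial (Fin 4) K}
    (h3 : g3 = initialForm K a 2) (h5 : g5 = initialForm K a 4 ∨ g5 = -initialForm K a 4)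
    (h6 : g6 = initialForm K a 5) :
    IsMinimallyGeneratedBy I ![x2 K ^ a.a12 * x3 K ^ a.a13, x3 K ^ a.a23 * x4 K ^ a.a24,
      g3, x4 K ^ a.a4, g5, g6] := by
  refine h.of_eq_or_eq_neg fun i => ?_
  fin_cases i
  exacts [.inl (initialForm_zero K D).symm, .inl (initialForm_one K D).symm, .inl h3,
    .inl (initialForm_three K D).symm, h5, .inl h6]

end MonomialCurve

theorem theorem2p13 (K : Type*) [Field K] (n : Fin 4 → ℕ) (hpos : 0 < n 0) (hn : StrictMono n)
    (hgcd : Finset.univ.gcd n = 1) (hCM : HasCohenMacaulayTangentCone K n)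
    (a : Exponents) (ha : IsCase2a K a n) (h24 : a.a24 < a.a34) (h13 : a.a13 ≤ a.a23) :
    IsStandardBasis NegDegRevLexGT {f1 K a, f2 K a, f3 K a, f4 K a, f5 K a, f6 K a}
        (toricIdeal K n) ∧
      (a.a3 < a.a31 + a.a34 → a.a2 + a.a12 < a.a1 + a.a24 + (a.a23 - a.a13) →
        a.a12 + a.a34 < a.a41 + a.a23 →
        IsMinimallyGeneratedBy (leastFormIdeal (toricIdeal K n))
          ![x2 K ^ a.a12 * x3 K ^ a.a13, x3 K ^ a.a23 * x4 K ^ a.a24,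
            x3 K ^ a.a3, x4 K ^ a.a4,
            x2 K ^ a.a12 * x4 K ^ a.a34,
            x2 K ^ (a.a2 + a.a12)]) ∧
      (a.a3 < a.a31 + a.a34 → a.a2 + a.a12 < a.a1 + a.a24 + (a.a23 - a.a13) →
        a.a12 + a.a34 = a.a41 + a.a23 →
        IsMinimallyGeneratedBy (leastFormIdeal (toricIdeal K n))
          ![x2 K ^ a.a12 * x3 K ^ a.a13, x3 K ^ a.a23 * x4 K ^ a.a24,
            x3 K ^ a.a3, x4 K ^ a.a4,
            x1 K ^ a.a41 * x3 K ^ a.a23 - x2 K ^ a.a12 * x4 K ^ a.a34,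
            x2 K ^ (a.a2 + a.a12)]) ∧
      (a.a3 < a.a31 + a.a34 → a.a2 + a.a12 = a.a1 + a.a24 + (a.a23 - a.a13) →
        a.a12 + a.a34 < a.a41 + a.a23 →
        IsMinimallyGeneratedBy (leastFormIdeal (toricIdeal K n))
          ![x2 K ^ a.a12 * x3 K ^ a.a13, x3 K ^ a.a23 * x4 K ^ a.a24,
            x3 K ^ a.a3, x4 K ^ a.a4,
            x2 K ^ a.a12 * x4 K ^ a.a34,
            x2 K ^ (a.a2 + a.a12) - x1 K ^ a.a1 * x3 K ^ (a.a23 - a.a13) * x4 K ^ a.a24]) ∧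
      (a.a3 < a.a31 + a.a34 → a.a2 + a.a12 = a.a1 + a.a24 + (a.a23 - a.a13) →
        a.a12 + a.a34 = a.a41 + a.a23 →
        IsMinimallyGeneratedBy (leastFormIdeal (toricIdeal K n))
          ![x2 K ^ a.a12 * x3 K ^ a.a13, x3 K ^ a.a23 * x4 K ^ a.a24,
            x3 K ^ a.a3, x4 K ^ a.a4,
            x1 K ^ a.a41 * x3 K ^ a.a23 - x2 K ^ a.a12 * x4 K ^ a.a34,
            x2 K ^ (a.a2 + a.a12) - x1 K ^ a.a1 * x3 K ^ (a.a23 - a.a13) * x4 K ^ a.a24]) ∧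
      (a.a3 = a.a31 + a.a34 → a.a2 + a.a12 < a.a1 + a.a24 + (a.a23 - a.a13) →
        a.a12 + a.a34 < a.a41 + a.a23 →
        IsMinimallyGeneratedBy (leastFormIdeal (toricIdeal K n))
          ![x2 K ^ a.a12 * x3 K ^ a.a13, x3 K ^ a.a23 * x4 K ^ a.a24,
            x3 K ^ a.a3 - x1 K ^ a.a31 * x4 K ^ a.a34, x4 K ^ a.a4,
            x2 K ^ a.a12 * x4 K ^ a.a34,
            x2 K ^ (a.a2 + a.a12)]) ∧
      (a.a3 = a.a31 + a.a34 → a.a2 + a.a12 < a.a1 + a.a24 + (a.a23 - a.a13) →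
        a.a12 + a.a34 = a.a41 + a.a23 →
        IsMinimallyGeneratedBy (leastFormIdeal (toricIdeal K n))
          ![x2 K ^ a.a12 * x3 K ^ a.a13, x3 K ^ a.a23 * x4 K ^ a.a24,
            x3 K ^ a.a3 - x1 K ^ a.a31 * x4 K ^ a.a34, x4 K ^ a.a4,
            x1 K ^ a.a41 * x3 K ^ a.a23 - x2 K ^ a.a12 * x4 K ^ a.a34,
            x2 K ^ (a.a2 + a.a12)]) ∧
      (a.a3 = a.a31 + a.a34 → a.a2 + a.a12 = a.a1 + a.a24 + (a.a23 - a.a13) →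
        a.a12 + a.a34 < a.a41 + a.a23 →
        IsMinimallyGeneratedBy (leastFormIdeal (toricIdeal K n))
          ![x2 K ^ a.a12 * x3 K ^ a.a13, x3 K ^ a.a23 * x4 K ^ a.a24,
            x3 K ^ a.a3 - x1 K ^ a.a31 * x4 K ^ a.a34, x4 K ^ a.a4,
            x2 K ^ a.a12 * x4 K ^ a.a34,
            x2 K ^ (a.a2 + a.a12) - x1 K ^ a.a1 * x3 K ^ (a.a23 - a.a13) * x4 K ^ a.a24]) ∧
      (a.a3 = a.a31 + a.a34 → a.a2 + a.a12 = a.a1 + a.a24 + (a.a23 - a.a13) →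
        a.a12 + a.a34 = a.a41 + a.a23 →
        IsMinimallyGeneratedBy (leastFormIdeal (toricIdeal K n))
          ![x2 K ^ a.a12 * x3 K ^ a.a13, x3 K ^ a.a23 * x4 K ^ a.a24,
            x3 K ^ a.a3 - x1 K ^ a.a31 * x4 K ^ a.a34, x4 K ^ a.a4,
            x1 K ^ a.a41 * x3 K ^ a.a23 - x2 K ^ a.a12 * x4 K ^ a.a34,
            x2 K ^ (a.a2 + a.a12) - x1 K ^ a.a1 * x3 K ^ (a.a23 - a.a13) * x4 K ^ a.a24]) := by
  have E := ha.exponentRelations fun i => hpos.trans_le (hn.monotone (Fin.zero_le i))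
  have D := ha.degreeInequalities E hn hCM h13
  have hmin := isMinimallyGeneratedBy_initialForm (K := K) E h13 D
  refine ⟨isStandardBasis E h13 D, ?_, ?_, ?_, ?_, ?_, ?_, ?_, ?_⟩ <;> intro c3 c6 c5 <;>
    apply D.isMinimallyGeneratedBy hmin <;>
    first
    | rw [initialForm_two, if_neg c3.ne]
    | rw [initialForm_two, if_pos c3]
    | rw [initialForm_five, if_neg c6.ne]
    | rw [initialForm_five, if_pos c6]
    | exact .inl (by rw [initialForm_four, if_neg c5.ne])
    -- The homogeneous `f_5` is listed with its tail monomial first, hence the sign.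
    | exact .inr (by rw [initialForm_four, if_pos c5, neg_sub])
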